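/- **Setting.** Let $\mathcal X$ be a measurable space, let $\mathcal Y=\mathcal S=\{0,1\}$, let $\mathcal Z=\mathcal X\times\mathcal Y$, and let $\mathcal P$ be a probability distribution of a data point $(Z,S)\in\mathcal Z\times\mathcal S$ (features and outcome $Z=(X,Y)$, protected class $S$) with $\pi_s=\Pr[S=s]>0$ for $s\in\{0,1\}$. Fix a classifier $f:\mathcal X\times\mathcal S\to\mathcal Y$ (which may ignore its second argument) and $\lambda\in\mathbb R$ (for example $\lambda\in[0,1]$). Let $\ell$ and $\mu$ be real-valued performance and fairness losses, for example $\{0,1\}$-valued indicators, such that $\ell(f,Z,S)$ and $\mu(f,Z,S)$ are random variables with finite variance. Let $\phi:\mathbb R^2\to\mathbb R$ be differentiable. For $s\in\{0,1\}$ let $L_{\mathcal P,s}(f)=\mathbb E[\ell(f,Z,S)\mid S=s]$ and $(\sigma_s^{\ell})^2=\operatorname{Var}[\ell(f,Z,S)\mid S=s]$, let $M_{\mathcal P,s}(f)$ and $(\sigma^\mu_s)^2$ be the conditional mean and variance of $\mu(f,Z,S)$ given $S=s$, and let $\operatorname{Cov}_s(\ell,\mu)$ be the conditional covariance of $\ell(f,Z,S)$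 and $\mu(f,Z,S)$ given $S=s$. The population risk is $$L_{\mathcal P}(f)=\lambda\,\mathbb E[\ell(f,Z,S)]+(1-\lambda)\,\phi\big(M_{\mathcal P,0}(f),M_{\mathcal P,1}(f)\big).$$ Let $(Z_1,S_1),(Z_2,S_2),\dots$ be iid with distribution $\mathcal P$, let $\mathcal D$ consist of the first $m$ of them, and let $m_s=|\{j\le m:S_j=s\}|$. The sample risk is $$L_{\mathcal D}(f)=\lambda\,\frac1m\sum_{j=1}^m\ell(f,Z_j,S_j)+(1-\lambda)\,\phi\Big(\frac1{m_0}\sum_{j\le m:\,S_j=0}\mu(f,Z_j,0),\ \frac1{m_1}\sum_{j\le m:\,S_j=1}\mu(f,Z_j,1)\Big),$$ where the mean over an empty group is set to $0$. **Theorem.** Let $(k_0,k_1)=\nabla\phi\big(M_{\mathcal P,0}(f),M_{\mathcal P,1}(f)\big)$ and $$\begin{aligned}\mathbb V_{\lim}(f)={}&\lambda^2\sum_{s}\pi_s(\sigma_s^{\ell})^2+\lambda^2\,\pi_0\pi_1\big(L_{\mathcal P,0}(f)-L_{\mathcal P,1}(f)\big)^2\\&+(1-\lambda)^2\sum_s k_s^2\,\frac{(\sigma_s^{\mu})^2}{\pi_s}+2\lambda(1-\lambda)\sum_s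 k_s\operatorname{Cov}_s(\ell,\mu).\end{aligned}$$ Then $\mathbb V_{\lim}(f)\ge 0$, and $$\sqrt m\,\big[L_{\mathcal D}(f)-L_{\mathcal P}(f)\big]\longrightarrow N\big(0,\mathbb V_{\lim}(f)\big)\quad\text{in distribution as }m\to\infty$$ (where $N(0,0)$ is the point mass at $0$). -/

import Mathlib

open MeasureTheory ProbabilityTheory Filter
open scoped ProbabilityTheory

noncomputable section

namespace FairRisk

/-- Data points `w = ((x, y), s)` with `z = (x, y)`: features `x`, binary outcome `y`,
binary protected class `s`. -/
abbrev Point (𝒳 : Type*) := (𝒳 × Fin 2) × Fin 2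

/-- Protected-class aware classifiers; an oblivious classifier `f₀ : 𝒳 → {0, 1}` is regarded as
the aware classifier `(x, s) ↦ f₀ x`. -/
abbrev Classifier (𝒳 : Type*) := 𝒳 × Fin 2 → Fin 2

/-- Losses, evaluated at a classifier `f` and a data point `(z, s)`.
Indicator losses are those with values in `{0, 1}`. -/
abbrev Loss (𝒳 : Type*) := Classifier 𝒳 → 𝒳 × Fin 2 → Fin 2 → ℝ

section Sample

variable {𝒳 : Type*} {m : ℕ}

/-- The number `m_s` of points of the data set in the group `S = s`. -/
def groupSize (D : Fin m → Point 𝒳) (s : Fin 2) : ℕ :=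
  (Finset.univ.filter fun j => (D j).2 = s).card

/-- The mean of the loss over the whole data set. -/
def sampleMean (ℓ : Loss 𝒳) (f : Classifier 𝒳) (D : Fin m → Point 𝒳) : ℝ :=
  (∑ j, ℓ f (D j).1 (D j).2) / m

/-- The mean of the loss over the points of the data set in the group `S = s`
(equal to `0` when the group is empty). -/
def groupSampleMean (μ : Loss 𝒳) (f : Classifier 𝒳) (D : Fin m → Point 𝒳) (s : Fin 2) : ℝ :=
  (∑ j ∈ Finset.univ.filter (fun j => (D j).2 = s), μ f (D j).1 (D j).2) / groupSize D s

/-- The sample risk `L_D(f)`. -/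
def sampleRisk (lam : ℝ) (ℓ μ : Loss 𝒳) (φ : EuclideanSpace ℝ (Fin 2) → ℝ) (f : Classifier 𝒳)
    (D : Fin m → Point 𝒳) : ℝ :=
  lam * sampleMean ℓ f D
    + (1 - lam) * φ !₂[groupSampleMean μ f D 0, groupSampleMean μ f D 1]

end Sample

section Population

variable {𝒳 : Type*} [MeasurableSpace 𝒳]

/-- The base rate `π_s = Pr[S = s]`. -/
def baseRate (P : Measure (Point 𝒳)) (s : Fin 2) : ℝ := P.real {w | w.2 = s}

/-- The conditional distribution of a data point given `S = s`. -/
def groupLaw (P : Measure (Point 𝒳)) (s : Fin 2) : Measure (Point 𝒳) :=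
  ProbabilityTheory.cond P {w | w.2 = s}

/-- The population mean of a loss in the group `S = s`. -/
def groupMean (P : Measure (Point 𝒳)) (ℓ : Loss 𝒳) (f : Classifier 𝒳) (s : Fin 2) : ℝ :=
  ∫ w, ℓ f w.1 w.2 ∂(groupLaw P s)

/-- The population variance of a loss in the group `S = s`. -/
def groupVar (P : Measure (Point 𝒳)) (ℓ : Loss 𝒳) (f : Classifier 𝒳) (s : Fin 2) : ℝ :=
  Var[fun w => ℓ f w.1 w.2; groupLaw P s]

/-- The population covariance of two losses in the group `S = s`. -/
def groupCov (P : Measure (Point 𝒳)) (ℓ μ : Loss 𝒳) (f : Classifier 𝒳) (s : Fin 2) : ℝ :=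
  cov[fun w => ℓ f w.1 w.2, fun w => μ f w.1 w.2; groupLaw P s]

/-- The point of `ℝ²` whose coordinates are the two group-wise population means of `μ`. -/
def groupMeans (P : Measure (Point 𝒳)) (μ : Loss 𝒳) (f : Classifier 𝒳) :
    EuclideanSpace ℝ (Fin 2) :=
  !₂[groupMean P μ f 0, groupMean P μ f 1]

/-- The population risk `L_P(f)`. -/
def populationRisk (P : Measure (Point 𝒳)) (lam : ℝ) (ℓ μ : Loss 𝒳)
    (φ : EuclideanSpace ℝ (Fin 2) → ℝ) (f : Classifier 𝒳) : ℝ :=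
  lam * (∫ w, ℓ f w.1 w.2 ∂P) + (1 - lam) * φ (groupMeans P μ f)

/-- The limiting variance; the second sum runs over the unordered pairs of distinct groups,
each counted once. -/
def limitVariance (P : Measure (Point 𝒳)) (lam : ℝ) (ℓ μ : Loss 𝒳)
    (φ : EuclideanSpace ℝ (Fin 2) → ℝ) (f : Classifier 𝒳) : ℝ :=
  let k : EuclideanSpace ℝ (Fin 2) := gradient φ (groupMeans P μ f)
  lam ^ 2 * ∑ s, baseRate P s * groupVar P ℓ f s
    + lam ^ 2 * ∑ p ∈ Finset.univ.filter (fun p : Fin 2 × Fin 2 => p.1 < p.2),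
        baseRate P p.1 * baseRate P p.2 * (groupMean P ℓ f p.1 - groupMean P ℓ f p.2) ^ 2
    + (1 - lam) ^ 2 * ∑ s, k s ^ 2 * (groupVar P μ f s / baseRate P s)
    + 2 * lam * (1 - lam) * ∑ s, k s * groupCov P ℓ μ f s

end Population

end FairRisk

end

/-!
The sample risk is a smooth function of sample means, so the delta method applies. Put
`k = ∇φ(M₀, M₁)` and let `R_s` be the loss `μ` centred at `M_s` on the group `S = s` and `0`
elsewhere (`FairRisk.groupResidual`); it has mean `0`. The error of the sample mean of `μ` in the
group `s` is the sample mean of `R_s` over all points divided by the frequency of the group, and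
this frequency tends to `π_s`. To first order the risk error is therefore the centred sample mean of
the influence function
`g = lam * ℓ + (1 - lam) * ∑ s, k_s * R_s / π_s` (`FairRisk.influence`).

* The central limit theorem for `g` gives the limit `N(0, Var g)`, and the law of total variance
  over the two groups identifies `Var g` with the limiting variance
  (`FairRisk.variance_influence`), which in particular is nonnegative.
* Almost surely, the linearization error is negligible against the sample means of the `R_s`
  (`FairRisk.ae_isLittleO_linearization_error`, from the deterministic expansion
  `isLittleO_differentiable_ratio` and the strong law of large numbers). Scaled by `√m`, these
  sample means are bounded in `L¹` (`integral_abs_sqrt_mul_mean_le`), so the scaled error tends to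
  `0` in probability (`tendstoInMeasure_zero_of_isLittleO`), and Slutsky's theorem concludes.
-/

/-! ### Negligible random sequences -/

open Asymptotics Topology in
/-- A random sequence that is almost surely negligible against one bounded in `L¹` tends to `0` in
probability: `D n / (1 + |B n|)` does so, and by Markov's inequality `|B n|` exceeds a large `R`
only with small probability. -/
theorem tendstoInMeasure_zero_of_isLittleO {Ω : Type*} [MeasurableSpace Ω] {Q : Measure Ω}
    [IsFiniteMeasure Q] {D B : ℕ → Ω → ℝ} {K : ℝ} (hD : ∀ n, AEMeasurable (D n) Q)
    (hB : ∀ n, Integrable (B n) Q) (hK : ∀ n, ∫ ω, |B n ω| ∂Q ≤ K)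
    (h : ∀ᵐ ω ∂Q, (fun n => D n ω) =o[atTop] fun n => B n ω) :
    TendstoInMeasure Q D atTop 0 := by
  have hC : TendstoInMeasure Q (fun n ω => D n ω / (1 + |B n ω|)) atTop 0 := by
    refine tendstoInMeasure_of_tendsto_ae (fun n => ?_) ?_
    · exact ((hD n).div ((hB n).aemeasurable.abs.const_add 1)).aestronglyMeasurable
    · filter_upwards [h] with ω hω
      refine IsLittleO.tendsto_div_nhds_zero (hω.trans_isBigO (IsBigO.of_bound 1 ?_))
      refine Eventually.of_forall fun n => ?_
      have := abs_nonneg (B n ω)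
      rw [Real.norm_eq_abs, Real.norm_eq_abs, abs_of_nonneg (by positivity : 0 ≤ 1 + |B n ω|)]
      linarith
  rw [tendstoInMeasure_iff_measureReal_norm] at hC ⊢
  intro ε hε
  have hK0 : 0 ≤ K := (integral_nonneg fun ω => abs_nonneg (B 0 ω)).trans (hK 0)
  rw [Metric.tendsto_atTop]
  intro η hη
  -- With this `R`, Markov's inequality bounds the probability of `R ≤ |B n|` by
  -- `K / R < η / 2`.
  set R : ℝ := 2 * (K + 1) / η with hRdef
  have hR : 0 < R := by positivity
  obtain ⟨N, hN⟩ := Metric.tendsto_atTop.1 (hC (ε / (1 + R)) (by positivity)) (η / 2)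
    (by positivity)
  refine ⟨N, fun n hn => ?_⟩
  have h1 := hN n hn
  rw [Real.dist_eq, sub_zero, abs_of_nonneg measureReal_nonneg] at h1 ⊢
  have h2 : Q.real {ω | R ≤ |B n ω|} < η / 2 := by
    have := mul_meas_ge_le_integral_of_nonneg (ae_of_all Q fun ω => abs_nonneg (B n ω))
      (hB n).abs R
    have h3 : R * (η / 2) = K + 1 := by rw [hRdef]; field_simp
    have h4 : R * Q.real {ω | R ≤ |B n ω|} < R * (η / 2) := by linarith [hK n]
    exact lt_of_mul_lt_mul_left h4 hR.le
  have h5 : {ω | ε ≤ ‖D n ω - (0 : Ω → ℝ) ω‖} ⊆ {ω | R ≤ |B n ω|} ∪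
      {ω | ε / (1 + R) ≤ ‖D n ω / (1 + |B n ω|) - (0 : Ω → ℝ) ω‖} := by
    intro ω hω
    by_cases hBR : R ≤ |B n ω|
    · exact Or.inl hBR
    · right
      have hp : 0 < 1 + |B n ω| := by positivity
      simp only [Set.mem_ofPred_eq, Pi.zero_apply, sub_zero, norm_div, Real.norm_eq_abs] at hω ⊢
      rw [abs_of_pos hp]
      exact div_le_div₀ (abs_nonneg _) hω hp (by linarith)
  have := (measureReal_mono (μ := Q) h5).trans (measureReal_union_le _ _)
  linarith

/-! ### Real functions of an independent sample -/

section IID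

variable {E Ω : Type*} [MeasurableSpace E] [MeasurableSpace Ω] {P : Measure E} {Q : Measure Ω}
  {W : ℕ → Ω → E} {g : E → ℝ}

theorem aemeasurable_comp_hasLaw (hlaw : ∀ j, HasLaw (W j) P Q) (hg : AEMeasurable g P) (j : ℕ) :
    AEMeasurable (fun ω => g (W j ω)) Q :=
  ((hlaw j).map_eq ▸ hg).comp_aemeasurable (hlaw j).aemeasurable

theorem integral_comp_hasLaw (hlaw : ∀ j, HasLaw (W j) P Q) (hg : AEMeasurable g P) (j : ℕ) :
    ∫ ω, g (W j ω) ∂Q = ∫ w, g w ∂P := by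
  rw [← (hlaw j).map_eq, integral_map (hlaw j).aemeasurable]
  exact ((hlaw j).map_eq ▸ hg).aestronglyMeasurable

theorem variance_comp_hasLaw (hlaw : ∀ j, HasLaw (W j) P Q) (hg : AEMeasurable g P) (j : ℕ) :
    Var[fun ω => g (W j ω); Q] = Var[g; P] := by
  rw [← (hlaw j).map_eq, variance_map ((hlaw j).map_eq ▸ hg) (hlaw j).aemeasurable]
  rfl

theorem memLp_comp_hasLaw {p : ENNReal} (hlaw : ∀ j, HasLaw (W j) P Q) (hg : MemLp g p P) (j : ℕ) :
    MemLp (fun ω => g (W j ω)) p Q :=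
  ((hlaw j).map_eq ▸ hg).comp_of_map (hlaw j).aemeasurable

theorem identDistrib_comp_hasLaw (hlaw : ∀ j, HasLaw (W j) P Q) (hg : AEMeasurable g P) (j : ℕ) :
    IdentDistrib (fun ω => g (W j ω)) (fun ω => g (W 0 ω)) Q Q :=
  IdentDistrib.comp_of_aemeasurable (u := g)
    ⟨(hlaw j).aemeasurable, (hlaw 0).aemeasurable, (hlaw j).map_eq.trans (hlaw 0).map_eq.symm⟩
    ((hlaw j).map_eq ▸ hg)

theorem iIndepFun_comp_hasLaw (hlaw : ∀ j, HasLaw (W j) P Q) (hindep : iIndepFun W Q)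
    (hg : AEMeasurable g P) : iIndepFun (fun j ω => g (W j ω)) Q :=
  hindep.comp₀ (fun _ => g) (fun j => (hlaw j).aemeasurable) fun j => (hlaw j).map_eq ▸ hg

theorem ae_tendsto_sum_div (hlaw : ∀ j, HasLaw (W j) P Q) (hindep : iIndepFun W Q)
    (hg : Integrable g P) :
    ∀ᵐ ω ∂Q, Tendsto (fun m : ℕ => (∑ j ∈ Finset.range m, g (W j ω)) / m) atTop
      (nhds (∫ w, g w ∂P)) := by
  have := strong_law_ae_real (μ := Q) (fun j ω => g (W j ω))
    (memLp_one_iff_integrable.1 (memLp_comp_hasLaw hlaw (memLp_one_iff_integrable.2 hg) 0))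
    (fun i j hij => (iIndepFun_comp_hasLaw hlaw hindep hg.aemeasurable).indepFun hij)
    (identDistrib_comp_hasLaw hlaw hg.aemeasurable)
  rwa [integral_comp_hasLaw hlaw hg.aemeasurable] at this

theorem memLp_sqrt_mul_mean (hlaw : ∀ j, HasLaw (W j) P Q) (hg : MemLp g 2 P) (m : ℕ) :
    MemLp (fun ω => √(m : ℝ) * ((∑ j ∈ Finset.range m, g (W j ω)) / m)) 2 Q := by
  simp only [div_eq_mul_inv]
  exact ((memLp_finsetSum _ fun j _ => memLp_comp_hasLaw hlaw hg j).mul_const _).const_mul _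

variable [IsProbabilityMeasure Q]

theorem tendstoInDistribution_sum_comp (hlaw : ∀ j, HasLaw (W j) P Q) (hindep : iIndepFun W Q)
    (hg : MemLp g 2 P) :
    TendstoInDistribution
      (fun (m : ℕ) ω => (√(m : ℝ))⁻¹ * (∑ j ∈ Finset.range m, g (W j ω) - m * ∫ w, g w ∂P))
      atTop (id : ℝ → ℝ) (fun _ => Q) (gaussianReal 0 Var[g; P].toNNReal) := by
  have hm := hg.aestronglyMeasurable.aemeasurable
  have := tendstoInDistribution_inv_sqrt_mul_sum_sub (P := Q) (X := fun j ω => g (W j ω))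
    (P' := gaussianReal 0 Var[g; P].toNNReal) (Y := id)
    (by rw [variance_comp_hasLaw hlaw hm]; exact HasLaw.id)
    (memLp_comp_hasLaw hlaw hg 0) (iIndepFun_comp_hasLaw hlaw hindep hm)
    (identDistrib_comp_hasLaw hlaw hm)
  simpa only [integral_comp_hasLaw hlaw hm] using this

/-- The variance of the scaled mean is at most `Var[g; P]`; the `L¹` bound comes from
`|x| ≤ 1 + x ^ 2`. -/
theorem integral_abs_sqrt_mul_mean_le (hlaw : ∀ j, HasLaw (W j) P Q) (hindep : iIndepFun W Q)
    (hg : MemLp g 2 P) (h0 : ∫ w, g w ∂P = 0) (m : ℕ) :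
    ∫ ω, |√(m : ℝ) * ((∑ j ∈ Finset.range m, g (W j ω)) / m)| ∂Q ≤ 1 + Var[g; P] := by
  have hm := hg.aestronglyMeasurable.aemeasurable
  set X : Ω → ℝ := fun ω => √(m : ℝ) * ((∑ j ∈ Finset.range m, g (W j ω)) / m) with hX
  have hXm : MemLp X 2 Q := memLp_sqrt_mul_mean hlaw hg m
  have hmean : ∫ ω, X ω ∂Q = 0 := by
    rw [hX, integral_const_mul, integral_div, integral_finsetSum]
    · simp [integral_comp_hasLaw hlaw hm, h0]
    · exact fun j _ => (memLp_comp_hasLaw hlaw hg j).integrable (by simp)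
  have hvar : Var[X; Q] ≤ Var[g; P] := by
    have e : X = fun ω =>
        (√(m : ℝ) * (m : ℝ)⁻¹) * (∑ j ∈ Finset.range m, fun ω => g (W j ω)) ω := by
      funext ω
      simp only [hX, Finset.sum_apply]
      ring
    rw [e, variance_const_mul, IndepFun.variance_sum (fun j _ => memLp_comp_hasLaw hlaw hg j)
      fun i _ j _ hij => (iIndepFun_comp_hasLaw hlaw hindep hm).indepFun hij]
    simp only [variance_comp_hasLaw hlaw hm, Finset.sum_const, Finset.card_range, nsmul_eq_mul]
    rw [mul_pow, Real.sq_sqrt (Nat.cast_nonneg m)]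
    rcases Nat.eq_zero_or_pos m with rfl | hpos
    · simp [variance_nonneg g P]
    · have : (m : ℝ) ≠ 0 := by positivity
      apply le_of_eq
      field_simp
  have hsq : ∫ ω, X ω ^ 2 ∂Q = Var[X; Q] :=
    (variance_of_integral_eq_zero hXm.aestronglyMeasurable.aemeasurable hmean).symm
  calc ∫ ω, |X ω| ∂Q ≤ ∫ ω, (1 + X ω ^ 2) ∂Q := by
        refine integral_mono (hXm.integrable (by simp)).abs
          ((integrable_const _).add hXm.integrable_sq) fun ω => ?_
        nlinarith [sq_abs (X ω), sq_nonneg (|X ω| - 1), abs_nonneg (X ω)]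
    _ = 1 + Var[X; Q] := by
        rw [integral_add (integrable_const _) hXm.integrable_sq, hsq]; simp
    _ ≤ 1 + Var[g; P] := by linarith

end IID

/-! ### Linearization of a function of ratios -/

open Asymptotics Topology in
/-- The deterministic part of the delta method for ratio estimators. If `x - M = A / p` in every
coordinate with `A → 0` and `p → q ≠ 0`, then `φ x - φ M` is `⟪∇φ M, A / q⟫` up to an error
negligible against `A`. The relation is stated in product form, as `p n s` may vanish for small
`n`. -/
theorem isLittleO_differentiable_ratio {ι : Type*} [Fintype ι] {φ : EuclideanSpace ℝ ι → ℝ}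
    {M : EuclideanSpace ℝ ι} (hφ : DifferentiableAt ℝ φ M) {x A p : ℕ → ι → ℝ} {q : ι → ℝ}
    (hq : ∀ s, q s ≠ 0) (hp : ∀ s, Tendsto (fun n => p n s) atTop (𝓝 (q s)))
    (hA : ∀ s, Tendsto (fun n => A n s) atTop (𝓝 0)) (hx : ∀ n s, p n s * (x n s - M s) = A n s) :
    (fun n => φ (WithLp.toLp 2 (x n)) - φ M - ∑ s, gradient φ M s * (A n s / q s))
      =o[atTop] fun n => ∑ s, |A n s| := by
  have hinv s : Tendsto (fun n => (p n s)⁻¹) atTop (𝓝 (q s)⁻¹) := (hp s).inv₀ (hq s)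
  have hxe s : (fun n => x n s - M s) =ᶠ[atTop] fun n => A n s * (p n s)⁻¹ := by
    filter_upwards [(hp s).eventually_ne (hq s)] with n hn
    rw [← hx n s]
    field_simp
  have hAO s : (fun n => A n s) =O[atTop] fun n => ∑ s, |A n s| := by
    refine IsBigO.of_bound 1 (Eventually.of_forall fun n => ?_)
    rw [one_mul, Real.norm_eq_abs, Real.norm_eq_abs]
    exact (Finset.single_le_sum (f := fun s => |A n s|) (fun _ _ => abs_nonneg _)
      (Finset.mem_univ s)).trans (le_abs_self _)
  have hxO s : (fun n => x n s - M s) =O[atTop] fun n => ∑ s, |A n s| := by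
    refine (hxe s).trans_isBigO ?_
    simpa using (hAO s).mul ((hinv s).isBigO_one ℝ)
  have hvO : (fun n => WithLp.toLp 2 (x n) - M) =O[atTop] fun n => ∑ s, |A n s| := by
    exact ((EuclideanSpace.equiv ι ℝ).isBigO_comp_rev _ _).trans (isBigO_pi.2 hxO)
  have hxlim : Tendsto (fun n => WithLp.toLp 2 (x n)) atTop (𝓝 M) := by
    rw [tendsto_iff_norm_sub_tendsto_zero]
    have : Tendsto (fun n => ∑ s, |A n s|) atTop (𝓝 0) := by
      simpa using tendsto_finsetSum Finset.univ fun s _ => (hA s).abs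
    exact (hvO.trans_tendsto this).norm.trans (by simp)
  -- The error of the linearization of `φ` at `M`.
  have h1 := ((hφ.hasGradientAt.hasFDerivAt.isLittleO).comp_tendsto hxlim).trans_isBigO hvO
  -- The error of replacing the random denominators `p` by their limits `q`.
  have h2 : (fun n => ∑ s, gradient φ M s * ((x n s - M s) - A n s / q s))
      =o[atTop] fun n => ∑ s, |A n s| := by
    refine IsLittleO.fun_sum fun s _ => IsLittleO.const_mul_left ?_ _
    have h3 : (fun n => A n s * ((p n s)⁻¹ - (q s)⁻¹)) =o[atTop] fun n => (∑ s, |A n s|) * 1 := by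
      refine (hAO s).mul_isLittleO ((isLittleO_one_iff ℝ).2 ?_)
      simpa using (hinv s).sub_const (q s)⁻¹
    simp only [mul_one] at h3
    refine EventuallyEq.trans_isLittleO ?_ h3
    filter_upwards [hxe s] with n hn
    rw [hn]
    ring
  refine (h1.add h2).congr_left fun n => ?_
  have h4 : InnerProductSpace.toDual ℝ (EuclideanSpace ℝ ι) (gradient φ M)
      (WithLp.toLp 2 (x n) - M) = ∑ s, gradient φ M s * (x n s - M s) := by
    rw [InnerProductSpace.toDual_apply_apply, PiLp.inner_apply]
    exact Finset.sum_congr rfl fun s _ => mul_comm _ _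
  simp only [Function.comp_apply, h4, mul_sub, Finset.sum_sub_distrib]
  ring

/-! ### Conditioning on the protected class -/

theorem memLp_cond {E : Type*} [MeasurableSpace E] {P : Measure E} {s : Set E} {p : ENNReal}
    {F : E → ℝ} (hs : P s ≠ 0) (hF : MemLp F p P) : MemLp F p P[|s] := by
  rw [ProbabilityTheory.cond]
  exact (hF.restrict s).smul_measure (ENNReal.inv_ne_top.2 hs)

namespace FairRisk

section Groups

variable {𝒳 : Type*} [MeasurableSpace 𝒳] {P : Measure (Point 𝒳)}

theorem measurableSet_group (s : Fin 2) : MeasurableSet {w : Point 𝒳 | w.2 = s} :=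
  measurable_snd (measurableSet_singleton s)

theorem groupLaw_ae_group (s : Fin 2) : ∀ᵐ w ∂groupLaw P s, w.2 = s :=
  ae_cond_mem (measurableSet_group s)

theorem memLp_groupLaw {s : Fin 2} {p : ENNReal} {F : Point 𝒳 → ℝ} (hπ : 0 < baseRate P s)
    (hF : MemLp F p P) : MemLp F p (groupLaw P s) := by
  have h : P {w | w.2 = s} ≠ 0 := fun h => hπ.ne' (by simp [baseRate, measureReal_def, h])
  exact memLp_cond h hF

variable [IsProbabilityMeasure P]

theorem isProbabilityMeasure_groupLaw {s : Fin 2} (hπ : 0 < baseRate P s) :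
    IsProbabilityMeasure (groupLaw P s) :=
  cond_isProbabilityMeasure fun h => hπ.ne' (by simp [baseRate, measureReal_def, h])

theorem sum_smul_groupLaw (P : Measure (Point 𝒳)) [IsFiniteMeasure P] :
    ∑ s, P {w | w.2 = s} • groupLaw P s = P :=
  sum_meas_smul_cond_fiber measurable_snd P

theorem integral_eq_sum_groupLaw {F : Point 𝒳 → ℝ} (hπ : ∀ s, 0 < baseRate P s)
    (hF : Integrable F P) :
    ∫ w, F w ∂P = ∑ s, baseRate P s * ∫ w, F w ∂groupLaw P s := by
  conv_lhs => rw [← sum_smul_groupLaw P]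
  rw [integral_finsetSum_measure]
  · simp [integral_smul_measure, baseRate, measureReal_def]
  · intro s _
    exact (memLp_one_iff_integrable.1 (memLp_groupLaw (hπ s)
      (memLp_one_iff_integrable.2 hF))).smul_measure (measure_ne_top _ _)

theorem sum_baseRate (P : Measure (Point 𝒳)) [IsProbabilityMeasure P]
    (hπ : ∀ s, 0 < baseRate P s) : baseRate P 0 + baseRate P 1 = 1 := by
  have := integral_eq_sum_groupLaw hπ (integrable_const (1 : ℝ))
  have h s := isProbabilityMeasure_groupLaw (hπ s)
  simpa using this.symm

/-- The law of total variance for the partition into the two groups. -/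
theorem variance_eq_within_add_between {F : Point 𝒳 → ℝ} (hπ : ∀ s, 0 < baseRate P s)
    (hF : MemLp F 2 P) :
    Var[F; P] = ∑ s, baseRate P s * Var[F; groupLaw P s]
      + baseRate P 0 * baseRate P 1
        * (∫ w, F w ∂groupLaw P 0 - ∫ w, F w ∂groupLaw P 1) ^ 2 := by
  have h s := isProbabilityMeasure_groupLaw (hπ s)
  have h1 := sum_baseRate P hπ
  rw [variance_eq_sub hF, integral_eq_sum_groupLaw hπ (hF.integrable (by simp)),
    integral_eq_sum_groupLaw hπ (F := F ^ 2) hF.integrable_sq]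
  simp only [Fin.sum_univ_two, variance_eq_sub (memLp_groupLaw (hπ _) hF)]
  rw [eq_sub_of_add_eq h1]
  ring

end Groups

/-! ### The influence function of the risk -/

section Influence

variable {𝒳 : Type*} [MeasurableSpace 𝒳]

/-- The loss `μ` centred at its mean in the group `S = s`, and `0` outside of that group. -/
noncomputable def groupResidual (P : Measure (Point 𝒳)) (μ : Loss 𝒳) (f : Classifier 𝒳) (s : Fin 2)
    (w : Point 𝒳) : ℝ :=
  if w.2 = s then μ f w.1 w.2 - groupMean P μ f s else 0

/-- The influence function of the risk functional at `P`, up to an additive constant: the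
performance part is not centred. The error of a group mean is a ratio whose denominator tends to
`π_s`, hence the factor `1 / π_s`. -/
noncomputable def influence (P : Measure (Point 𝒳)) (lam : ℝ) (ℓ μ : Loss 𝒳)
    (φ : EuclideanSpace ℝ (Fin 2) → ℝ) (f : Classifier 𝒳) (w : Point 𝒳) : ℝ :=
  lam * ℓ f w.1 w.2 + (1 - lam) *
    ∑ s, gradient φ (groupMeans P μ f) s * (groupResidual P μ f s w / baseRate P s)

variable {P : Measure (Point 𝒳)} {lam : ℝ} {ℓ μ : Loss 𝒳}
  {φ : EuclideanSpace ℝ (Fin 2) → ℝ} {f : Classifier 𝒳}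

theorem influence_ae_eq (s : Fin 2) :
    influence P lam ℓ μ φ f =ᵐ[groupLaw P s] fun w => lam * ℓ f w.1 w.2 +
      (1 - lam) * gradient φ (groupMeans P μ f) s / baseRate P s *
        (μ f w.1 w.2 - groupMean P μ f s) := by
  filter_upwards [groupLaw_ae_group s] with w hw
  simp only [influence, groupResidual, hw]
  rw [Finset.sum_eq_single s (fun t _ hts => by simp [hts.symm]) (by simp)]
  simp only [if_true]
  ring

variable [IsProbabilityMeasure P]

theorem memLp_groupResidual (hμ : MemLp (fun w : Point 𝒳 => μ f w.1 w.2) 2 P) (s : Fin 2) :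
    MemLp (groupResidual P μ f s) 2 P := by
  have := (hμ.sub (memLp_const (groupMean P μ f s))).indicator (measurableSet_group s)
  refine (memLp_congr_ae (Eventually.of_forall fun w => ?_)).1 this
  simp [Set.indicator_apply, groupResidual]

theorem integral_groupResidual (hπ : ∀ s, 0 < baseRate P s)
    (hμ : MemLp (fun w : Point 𝒳 => μ f w.1 w.2) 2 P) (s : Fin 2) :
    ∫ w, groupResidual P μ f s w ∂P = 0 := by
  rw [integral_eq_sum_groupLaw hπ ((memLp_groupResidual hμ s).integrable (by simp))]
  refine Finset.sum_eq_zero fun t _ => mul_eq_zero_of_right _ ?_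
  have h := isProbabilityMeasure_groupLaw (hπ t)
  by_cases hts : t = s
  · subst hts
    have : groupResidual P μ f t =ᵐ[groupLaw P t] fun w => μ f w.1 w.2 - groupMean P μ f t := by
      filter_upwards [groupLaw_ae_group t] with w hw
      simp [groupResidual, hw]
    rw [integral_congr_ae this, integral_sub
      ((memLp_groupLaw (hπ t) hμ).integrable (by simp)) (integrable_const _)]
    simp [groupMean]
  · have : groupResidual P μ f s =ᵐ[groupLaw P t] 0 := by
      filter_upwards [groupLaw_ae_group t] with w hw
      simp [groupResidual, hw, hts]
    rw [integral_congr_ae this]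
    simp

theorem memLp_influence (hℓ : MemLp (fun w : Point 𝒳 => ℓ f w.1 w.2) 2 P)
    (hμ : MemLp (fun w : Point 𝒳 => μ f w.1 w.2) 2 P) :
    MemLp (influence P lam ℓ μ φ f) 2 P := by
  refine (hℓ.const_mul lam).add (MemLp.const_mul
    (memLp_finsetSum (f := fun s w => gradient φ (groupMeans P μ f) s *
      (groupResidual P μ f s w / baseRate P s)) Finset.univ fun s _ => ?_) _)
  simp only [div_eq_mul_inv]
  exact ((memLp_groupResidual hμ s).mul_const _).const_mul _

theorem integral_influence (hπ : ∀ s, 0 < baseRate P s)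
    (hℓ : MemLp (fun w : Point 𝒳 => ℓ f w.1 w.2) 2 P)
    (hμ : MemLp (fun w : Point 𝒳 => μ f w.1 w.2) 2 P) :
    ∫ w, influence P lam ℓ μ φ f w ∂P = lam * ∫ w, ℓ f w.1 w.2 ∂P := by
  have hint s : Integrable (fun w => gradient φ (groupMeans P μ f) s *
      (groupResidual P μ f s w / baseRate P s)) P :=
    (((memLp_groupResidual hμ s).integrable (by simp)).div_const _).const_mul _
  unfold influence
  rw [integral_add ((hℓ.integrable (by simp)).const_mul _)
    ((integrable_finsetSum _ fun s _ => hint s).const_mul _), integral_const_mul,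
    integral_const_mul, integral_finsetSum _ fun s _ => hint s]
  simp [integral_const_mul, integral_div, integral_groupResidual hπ hμ]

/-- By the law of total variance: in the group `S = s` the influence function is
`lam * ℓ + a * (μ - M_s)` with `a = (1 - lam) * k_s / π_s`, so its group mean is `lam * L_s` and its
group variance is expanded bilinearly. -/
theorem variance_influence (hπ : ∀ s, 0 < baseRate P s)
    (hℓ : MemLp (fun w : Point 𝒳 => ℓ f w.1 w.2) 2 P)
    (hμ : MemLp (fun w : Point 𝒳 => μ f w.1 w.2) 2 P) :
    Var[influence P lam ℓ μ φ f; P] = limitVariance P lam ℓ μ φ f := by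
  have hprob s := isProbabilityMeasure_groupLaw (hπ s)
  have hℓs s := memLp_groupLaw (hπ s) hℓ
  have hμs s := memLp_groupLaw (hπ s) hμ
  have hμc s : MemLp (fun w => μ f w.1 w.2 - groupMean P μ f s) 2 (groupLaw P s) :=
    (hμs s).sub (memLp_const _)
  have hmean s : ∫ w, influence P lam ℓ μ φ f w ∂groupLaw P s = lam * groupMean P ℓ f s := by
    rw [integral_congr_ae (influence_ae_eq s), integral_add
      (((hℓs s).integrable (by simp)).const_mul _)
      (((hμc s).integrable (by simp)).const_mul _),
      integral_const_mul, integral_const_mul,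
      integral_sub ((hμs s).integrable (by simp)) (integrable_const _)]
    simp [groupMean]
  have hvar s : Var[influence P lam ℓ μ φ f; groupLaw P s] = lam ^ 2 * groupVar P ℓ f s
      + 2 * (lam * ((1 - lam) * gradient φ (groupMeans P μ f) s / baseRate P s *
        groupCov P ℓ μ f s))
      + ((1 - lam) * gradient φ (groupMeans P μ f) s / baseRate P s) ^ 2 * groupVar P μ f s := by
    rw [variance_congr (influence_ae_eq s), variance_fun_add ((hℓs s).const_mul _)
      ((hμc s).const_mul _), variance_const_mul, variance_const_mul,
      variance_sub_const (hμs s).aestronglyMeasurable, covariance_const_mul_left,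
      covariance_const_mul_right, covariance_sub_const_right ((hμs s).integrable (by simp))]
    rfl
  rw [variance_eq_within_add_between hπ (memLp_influence hℓ hμ)]
  simp only [hmean, hvar, limitVariance, Finset.sum_filter, Fintype.sum_prod_type,
    Fin.sum_univ_two]
  have h0 := (hπ 0).ne'
  have h1 := (hπ 1).ne'
  simp
  field_simp
  ring

end Influence

/-! ### The linearization error of the sample risk -/

section LinearizationError

theorem groupSize_eq_sum_range {𝒳 : Type*} (w : ℕ → Point 𝒳) (m : ℕ) (s : Fin 2) :
    (groupSize (fun j : Fin m => w j) s : ℝ) =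
      ∑ j ∈ Finset.range m, if (w j).2 = s then (1 : ℝ) else 0 := by
  rw [Finset.sum_range fun j => if (w j).2 = s then (1 : ℝ) else 0]
  simp [groupSize]

variable {𝒳 : Type*} [MeasurableSpace 𝒳] {P : Measure (Point 𝒳)}
  {lam : ℝ} {ℓ μ : Loss 𝒳} {φ : EuclideanSpace ℝ (Fin 2) → ℝ} {f : Classifier 𝒳}
  {Ω : Type*} [MeasurableSpace Ω] {Q : Measure Ω}
  {W : ℕ → Ω → Point 𝒳}

/-- The ratio form of the error of a group mean, stated without division by the group size so
that it also holds when the group is empty. -/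
theorem groupSize_div_mul_groupSampleMean_sub (w : ℕ → Point 𝒳) (m : ℕ) (s : Fin 2) :
    (groupSize (fun j : Fin m => w j) s : ℝ) / m *
        (groupSampleMean μ f (fun j : Fin m => w j) s - groupMean P μ f s) =
      (∑ j ∈ Finset.range m, groupResidual P μ f s (w j)) / m := by
  have h : (∑ j ∈ Finset.range m, groupResidual P μ f s (w j)) =
      (∑ j ∈ Finset.univ.filter (fun j : Fin m => (w j).2 = s), μ f (w j).1 (w j).2) -
        groupSize (fun j : Fin m => w j) s * groupMean P μ f s := by
    rw [Finset.sum_range fun j => groupResidual P μ f s (w j)]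
    simp only [groupResidual, ← Finset.sum_filter, Finset.sum_sub_distrib, Finset.sum_const,
      nsmul_eq_mul, groupSize]
  rw [h, groupSampleMean]
  -- For an empty group the left side vanishes through its first factor, the right side as an
  -- empty sum.
  rcases eq_or_ne (groupSize (fun j : Fin m => w j) s) 0 with h0 | h0
  · have : (Finset.univ.filter fun j : Fin m => (w j).2 = s) = ∅ := Finset.card_eq_zero.1 h0
    simp [h0, this]
  · have : (groupSize (fun j : Fin m => w j) s : ℝ) ≠ 0 := by exact_mod_cast h0
    field_simp

theorem aemeasurable_sampleRisk (hℓ : AEMeasurable (fun w : Point 𝒳 => ℓ f w.1 w.2) P)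
    (hμ : AEMeasurable (fun w : Point 𝒳 => μ f w.1 w.2) P) (hφ : Differentiable ℝ φ)
    (hlaw : ∀ j, HasLaw (W j) P Q) (m : ℕ) :
    AEMeasurable (fun ω => sampleRisk lam ℓ μ φ f fun j : Fin m => W j ω) Q := by
  have hgroup (s : Fin 2) : AEMeasurable
      (fun ω => groupSampleMean μ f (fun j : Fin m => W j ω) s) Q := by
    have hsize ω := groupSize_eq_sum_range (fun j => W j ω) m s
    simp only [groupSampleMean, hsize, Finset.sum_filter]
    refine (Finset.aemeasurable_fun_sum _ fun j _ => ?_).div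
      (Finset.aemeasurable_fun_sum _ fun j _ => ?_)
    · refine (aemeasurable_comp_hasLaw hlaw (hμ.indicator (measurableSet_group s)) j).congr
        (Eventually.of_forall fun ω => ?_)
      simp [Set.indicator_apply]
    · exact (Measurable.ite (measurableSet_group s) measurable_const
        measurable_const).comp_aemeasurable (hlaw j).aemeasurable
  refine AEMeasurable.add (AEMeasurable.const_mul ?_ _) (AEMeasurable.const_mul ?_ _)
  · exact (Finset.aemeasurable_fun_sum (Finset.univ : Finset (Fin m)) fun j _ =>
      aemeasurable_comp_hasLaw hlaw hℓ j).div_const _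
  · refine hφ.continuous.measurable.comp_aemeasurable
      ((WithLp.measurable_toLp 2 _).comp_aemeasurable (aemeasurable_pi_lambda _ fun s => ?_))
    fin_cases s
    · exact hgroup 0
    · exact hgroup 1

variable [IsProbabilityMeasure P]

/-- The performance part of the risk is linear in the empirical measure, hence contributes nothing
to the linearization error, which is that of `φ` at the two group means. -/
theorem scaled_linearization_error_eq (w : ℕ → Point 𝒳) (hπ : ∀ s, 0 < baseRate P s)
    (hℓ : MemLp (fun w : Point 𝒳 => ℓ f w.1 w.2) 2 P)
    (hμ : MemLp (fun w : Point 𝒳 => μ f w.1 w.2) 2 P) (m : ℕ) :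
    √(m : ℝ) * (sampleRisk lam ℓ μ φ f (fun j : Fin m => w j) - populationRisk P lam ℓ μ φ f)
      - (√(m : ℝ))⁻¹ * (∑ j ∈ Finset.range m, influence P lam ℓ μ φ f (w j)
          - m * ∫ w, influence P lam ℓ μ φ f w ∂P) =
    (1 - lam) * (√(m : ℝ) *
      (φ (WithLp.toLp 2 (groupSampleMean μ f fun j : Fin m => w j)) - φ (groupMeans P μ f)
        - ∑ s, gradient φ (groupMeans P μ f) s *
          ((∑ j ∈ Finset.range m, groupResidual P μ f s (w j)) / m / baseRate P s))) := by
  rcases Nat.eq_zero_or_pos m with rfl | hm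
  · simp
  have hm' : (m : ℝ) ≠ 0 := by positivity
  have hs : (√(m : ℝ))⁻¹ = √(m : ℝ) / m := by
    rw [Real.sqrt_div_self', one_div]
  have hv : !₂[groupSampleMean μ f (fun j : Fin m => w j) 0,
      groupSampleMean μ f (fun j : Fin m => w j) 1] =
      WithLp.toLp 2 (groupSampleMean μ f fun j : Fin m => w j) := by
    ext s; fin_cases s <;> rfl
  rw [hs, integral_influence hπ hℓ hμ, sampleRisk, hv, populationRisk, sampleMean,
    ← Finset.sum_range fun j => ℓ f (w j).1 (w j).2]
  simp only [influence, Finset.sum_add_distrib, ← Finset.mul_sum, Fin.sum_univ_two,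
    ← Finset.sum_div]
  field_simp
  ring

/-- Almost surely, the linearization error, scaled by `√m`, is negligible against the scaled sample
means of the group residuals: by the strong law the group frequencies converge to the base rates and
the sample means of the residuals to `0`, so the deterministic expansion applies. -/
theorem ae_isLittleO_linearization_error (hπ : ∀ s, 0 < baseRate P s)
    (hℓ : MemLp (fun w : Point 𝒳 => ℓ f w.1 w.2) 2 P)
    (hμ : MemLp (fun w : Point 𝒳 => μ f w.1 w.2) 2 P) (hφ : Differentiable ℝ φ)
    (hlaw : ∀ j, HasLaw (W j) P Q) (hindep : iIndepFun W Q) :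
    ∀ᵐ ω ∂Q, (fun m : ℕ => √(m : ℝ) * (sampleRisk lam ℓ μ φ f (fun j : Fin m => W j ω)
          - populationRisk P lam ℓ μ φ f)
        - (√(m : ℝ))⁻¹ * (∑ j ∈ Finset.range m, influence P lam ℓ μ φ f (W j ω)
          - m * ∫ w, influence P lam ℓ μ φ f w ∂P)) =o[atTop]
      fun m : ℕ => ∑ s, |√(m : ℝ) *
        ((∑ j ∈ Finset.range m, groupResidual P μ f s (W j ω)) / m)| := by
  have hres : ∀ᵐ ω ∂Q, ∀ s, Tendsto
      (fun m : ℕ => (∑ j ∈ Finset.range m, groupResidual P μ f s (W j ω)) / m) atTop (nhds 0) := by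
    refine ae_all_iff.2 fun s => ?_
    have := ae_tendsto_sum_div hlaw hindep ((memLp_groupResidual hμ s).integrable (by simp))
    rwa [integral_groupResidual hπ hμ] at this
  have hrate : ∀ᵐ ω ∂Q, ∀ s, Tendsto
      (fun m : ℕ => (groupSize (fun j : Fin m => W j ω) s : ℝ) / m) atTop
      (nhds (baseRate P s)) := by
    refine ae_all_iff.2 fun s => ?_
    have := ae_tendsto_sum_div hlaw hindep (g := {w : Point 𝒳 | w.2 = s}.indicator fun _ => (1 : ℝ))
      ((integrable_const 1).indicator (measurableSet_group s))
    rw [integral_indicator_const _ (measurableSet_group s)] at this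
    filter_upwards [this] with ω hω
    simp only [groupSize_eq_sum_range fun j => W j ω]
    simpa [Set.indicator_apply, baseRate] using hω
  filter_upwards [hres, hrate] with ω h1 h2
  have hMs : ∀ s, groupMeans P μ f s = groupMean P μ f s := by
    intro s; fin_cases s <;> rfl
  have := isLittleO_differentiable_ratio (φ := φ) (M := groupMeans P μ f) hφ.differentiableAt
    (x := fun m => groupSampleMean μ f fun j : Fin m => W j ω) (fun s => (hπ s).ne') h2 h1
    fun m s => by rw [hMs, groupSize_div_mul_groupSampleMean_sub fun j => W j ω]
  simp only [scaled_linearization_error_eq (fun j => W j ω) hπ hℓ hμ]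
  refine ((Asymptotics.isBigO_refl (fun m : ℕ => √(m : ℝ)) atTop).mul_isLittleO
    this).const_mul_left (1 - lam) |>.congr_right fun m => ?_
  simp only [abs_mul, abs_of_nonneg (Real.sqrt_nonneg _), Finset.mul_sum]

end LinearizationError

end FairRisk

/-! ### Asymptotic normality of the risk -/

theorem mainTheorem1 {𝒳 : Type*} [MeasurableSpace 𝒳]
    (P : Measure (FairRisk.Point 𝒳)) [IsProbabilityMeasure P]
    (hπ : ∀ s : Fin 2, 0 < FairRisk.baseRate P s)
    (lam : ℝ) (f : FairRisk.Classifier 𝒳) (ℓ μ : FairRisk.Loss 𝒳)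
    (hℓ : MemLp (fun w : FairRisk.Point 𝒳 => ℓ f w.1 w.2) 2 P)
    (hμ : MemLp (fun w : FairRisk.Point 𝒳 => μ f w.1 w.2) 2 P)
    (φ : EuclideanSpace ℝ (Fin 2) → ℝ) (hφ : Differentiable ℝ φ)
    {Ω : Type*} [MeasurableSpace Ω] (Q : Measure Ω) [IsProbabilityMeasure Q]
    (W : ℕ → Ω → FairRisk.Point 𝒳)
    (hlaw : ∀ j, HasLaw (W j) P Q) (hindep : iIndepFun W Q) :
    0 ≤ FairRisk.limitVariance P lam ℓ μ φ f ∧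
    TendstoInDistribution
      (fun (m : ℕ) (ω : Ω) =>
        √(m : ℝ) * (FairRisk.sampleRisk lam ℓ μ φ f (fun j : Fin m => W j ω)
          - FairRisk.populationRisk P lam ℓ μ φ f))
      atTop (id : ℝ → ℝ) (fun _ => Q)
      (gaussianReal 0 (FairRisk.limitVariance P lam ℓ μ φ f).toNNReal) := by
  rw [← FairRisk.variance_influence hπ hℓ hμ]
  refine ⟨variance_nonneg _ _, ?_⟩
  have hclt := tendstoInDistribution_sum_comp hlaw hindep
    (FairRisk.memLp_influence (lam := lam) (φ := φ) hℓ hμ)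
  have hmeas (m : ℕ) : AEMeasurable (fun ω => √(m : ℝ) *
      (FairRisk.sampleRisk lam ℓ μ φ f (fun j : Fin m => W j ω)
        - FairRisk.populationRisk P lam ℓ μ φ f)) Q :=
    ((FairRisk.aemeasurable_sampleRisk hℓ.aestronglyMeasurable.aemeasurable
      hμ.aestronglyMeasurable.aemeasurable hφ hlaw m).sub_const _).const_mul _
  -- Slutsky: it remains to see that the linearization error vanishes in probability.
  refine tendstoInDistribution_of_tendstoInMeasure_sub _ _ hclt ?_ hmeas
  have hres (s : Fin 2) (m : ℕ) := memLp_sqrt_mul_mean hlaw (FairRisk.memLp_groupResidual hμ s) m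
  have hint (s : Fin 2) (m : ℕ) := ((hres s m).integrable (by simp)).abs
  refine tendstoInMeasure_zero_of_isLittleO
    (K := ∑ s, (1 + Var[FairRisk.groupResidual P μ f s; P]))
    (fun m => (hmeas m).sub (hclt.forall_aemeasurable m))
    (fun m => integrable_finsetSum Finset.univ fun s _ => hint s m) (fun m => ?_)
    (FairRisk.ae_isLittleO_linearization_error hπ hℓ hμ hφ hlaw hindep)
  simp only [Finset.abs_sum_of_nonneg' fun _ => abs_nonneg _]
  rw [integral_finsetSum _ fun s _ => hint s m]
  exact Finset.sum_le_sum fun s _ => integral_abs_sqrt_mul_mean_le hlaw hindep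
    (FairRisk.memLp_groupResidual hμ s) (FairRisk.integral_groupResidual hπ hμ s) m
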